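/- Let $k$ be a field. Let $\mathrm{Mod}\text{-}\Omega$ be the category of differential graded $k$-vector spaces $Y_*$ graded by $\mathbb N$, with differential of degree $-1$, and let $\mathrm{Mod}\text{-}\Delta$ be the category of simplicial $k$-vector spaces. Let $\mathrm{CoInd}=\mathrm{CoInd}_\Delta^\Omega\colon \mathrm{Mod}\text{-}\Delta\to\mathrm{Mod}\text{-}\Omega$ be the normalized Moore complex functor $$\mathrm{CoInd}(X)_n=N_n(X)=\{x\in X_n \mid \partial_i x=0 \text{ for } 1\le i\le n\},\qquad d=\partial_0 ,$$ and let $\mathrm{Res}\colon \mathrm{Mod}\text{-}\Omega\to\mathrm{Mod}\text{-}\Delta$ be its left adjoint, namely the Dold-Kan functor $\Gamma$, $\Gamma(Y)_n=\bigoplus_{[n]\twoheadrightarrow[p]}Y_p$ (unique up to natural isomorphism). For a simplicial vector space $X$ and $n\ge 0$ let $\pi_n(X)=Z_n/{\sim}$, where $Z_n=\{x\in X_n\mid \partial_i x=0,\ 0\le i\le n\}$ (with $Z_0=X_0$), and $x\sim x'$ if there is $y\in X_{n+1}$ with $\partial_i y=0$ for $i<n$, $\partial_n y=x$, $\partial_{n+1}y=x'$.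 Then: 1. $\mathrm{Mod}\text{-}\Omega$ has a cofibrantly generated model structure in which the cofibrations are the monomorphisms, the weak equivalences are the quasi-isomorphisms, and the fibrations are the morphisms with the right lifting property against all trivial cofibrations. 2. This model structure is transferred to $\mathrm{Mod}\text{-}\Delta$ along the right adjoint $\mathrm{CoInd}$: there is a cofibrantly generated model structure on $\mathrm{Mod}\text{-}\Delta$ in which a morphism $f$ is a weak equivalence (resp. a fibration) if and only if $\mathrm{CoInd}(f)$ is one, and the cofibrations are the morphisms with the left lifting property against all trivial fibrations. Its cofibrations are exactly the monomorphisms, and its weak equivalences are exactly the homotopy equivalences, i.e. the morphisms inducing isomorphisms on $\pi_n$ for all $n\ge 0$. 3. For these model structures the Dold-Kan adjunction $\mathrm{Res}\dashv\mathrm{CoInd}$ is a Quillen equivalence: $\mathrm{Res}$ preserves cofibrations and trivial cofibrations, and for every cofibrant $Y$ in $\mathrm{Mod}\text{-}\Omega$ and fibrant $X$ in $\mathrm{Mod}\text{-}\Delta$ a morphism $\mathrm{Res}(Y)\to X$ is a weak equivalence if and only if its adjoint $Y\to\mathrm{CoInd}(X)$ is. -/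

import Mathlib

open CategoryTheory CategoryTheory.Limits HomotopicalAlgebra Opposite
open scoped Simplicial

universe u

namespace DoldKanQuillen

/-! ## The two categories and the Dold-Kan pair -/

section Categories

variable (k : Type u) [Field k]

/-- Right `Ω`-modules: differential graded `k`-vector spaces, graded by `ℕ`, whose differential
lowers the degree by one. -/
abbrev DGMod : Type (u + 1) := ChainComplex (ModuleCat.{u} k) ℕ

/-- Right `Δ`-modules: simplicial `k`-vector spaces. -/
abbrev SMod : Type (u + 1) := SimplicialObject (ModuleCat.{u} k)

/-- The coinduction functor, sending `X` to the normalized Moore complex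
`N_n X = {x ∈ X_n | ∂_i x = 0 for 1 ≤ i ≤ n}` with differential `∂_0`. -/
noncomputable abbrev coInd : SMod k ⥤ DGMod k :=
  AlgebraicTopology.normalizedMooreComplex (ModuleCat.{u} k)

/-- The left adjoint of `coInd`: Kan's functor, with
`(Γ Y)_n = ⨁_{[n] ↠ [p]} Y_p`. -/
noncomputable abbrev res : DGMod k ⥤ SMod k :=
  Abelian.DoldKan.Γ

/-- The Dold-Kan equivalence as an adjoint pair, the coinduction functor on the right. -/
noncomputable def doldKanAdjunction : res k ⊣ coInd k :=
  (Abelian.DoldKan.equivalence (A := ModuleCat.{u} k)).symm.toAdjunction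

end Categories

/-! ## Homotopy groups of simplicial vector spaces -/

section Homotopy

variable {k : Type u} [Field k]

/-- `Z_n X`: the `x ∈ X_n` all of whose faces vanish (there are no faces if `n = 0`). -/
def cycles (X : SMod k) (n : ℕ) : Set (X _⦋n⦌) :=
  match n with
  | 0 => Set.univ
  | m + 1 => {x : X _⦋m + 1⦌ | ∀ i : Fin (m + 2), X.δ i x = 0}

/-- `x ∼ x'` if some `y ∈ X_{n+1}` has `∂_i y = 0` for `i < n`, `∂_n y = x` and
`∂_{n+1} y = x'`. -/
def CycleRel (X : SMod k) (n : ℕ) (x x' : cycles X n) : Prop :=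
  ∃ y : X _⦋n + 1⦌, (∀ i : Fin (n + 2), (i : ℕ) < n → X.δ i y = 0) ∧
    X.δ (Fin.last n).castSucc y = x.1 ∧ X.δ (Fin.last (n + 1)) y = x'.1

/-- The combinatorial homotopy group `π_n X = Z_n X / ∼` (its underlying set). -/
def HomotopyGroup (X : SMod k) (n : ℕ) : Type u := Quot (CycleRel X n)

theorem map_face {X Y : SMod k} (f : X ⟶ Y) {n : ℕ} (i : Fin (n + 2)) (x : X _⦋n + 1⦌) :
    Y.δ i (f.app (op ⦋n + 1⦌) x) = f.app (op ⦋n⦌) (X.δ i x) := by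
  have h := ConcreteCategory.congr_hom (SimplicialObject.δ_naturality f i) x
  simpa only [ConcreteCategory.comp_apply] using h.symm

theorem map_mem_cycles {X Y : SMod k} (f : X ⟶ Y) (n : ℕ) {x : X _⦋n⦌} (hx : x ∈ cycles X n) :
    f.app (op ⦋n⦌) x ∈ cycles Y n := by
  cases n with
  | zero => exact Set.mem_univ _
  | succ m =>
    intro i
    rw [map_face]
    exact (congrArg _ (hx i)).trans (map_zero _)

/-- The map `π_n X → π_n Y` induced by a morphism of simplicial vector spaces. -/
def homotopyGroupMap {X Y : SMod k} (f : X ⟶ Y) (n : ℕ) :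
    HomotopyGroup X n → HomotopyGroup Y n :=
  Quot.map (fun x => ⟨f.app (op ⦋n⦌) x.1, map_mem_cycles f n x.2⟩) (by
    rintro x x' ⟨y, h₀, h₁, h₂⟩
    refine ⟨f.app (op ⦋n + 1⦌) y, fun i hi => ?_, ?_, ?_⟩
    · rw [map_face, h₀ i hi, map_zero]
    · rw [map_face, h₁]
    · rw [map_face, h₂])

/-- Homotopy equivalences of simplicial vector spaces: the morphisms inducing isomorphisms on
all combinatorial homotopy groups. -/
def homotopyEquivalences (k : Type u) [Field k] : MorphismProperty (SMod k) :=
  fun _ _ f => ∀ n : ℕ, Function.Bijective (homotopyGroupMap f n)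

end Homotopy

/-! ## Model categories -/

section Model

universe w v₁ v₂ u₁ u₂

/-- A model category is cofibrantly generated if there are (essentially `w`-small) classes `I`,
`J` permitting the small object argument such that the trivial fibrations and the fibrations are
the morphisms with the right lifting property against `I` and `J` respectively. -/
def IsCofibrantlyGenerated (C : Type u₁) [Category.{v₁} C] [ModelCategory C] : Prop :=
  ∃ I J : MorphismProperty C,
    MorphismProperty.HasSmallObjectArgument.{w} I ∧
    MorphismProperty.HasSmallObjectArgument.{w} J ∧
    trivialFibrations C = I.rlp ∧ fibrations C = J.rlp

variable {C : Type u₁} [Category.{v₁} C] [ModelCategory C]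
  {D : Type u₂} [Category.{v₂} D] [ModelCategory D]

/-- The model structure of `D` is transferred from `C` along the functor `G : D ⥤ C`: weak
equivalences and fibrations are created by `G`, and cofibrations are the morphisms with the
left lifting property against the trivial fibrations. -/
structure IsTransferredAlong (G : D ⥤ C) : Prop where
  weakEquivalences_eq : weakEquivalences D = (weakEquivalences C).inverseImage G
  fibrations_eq : fibrations D = (fibrations C).inverseImage G
  cofibrations_eq : cofibrations D = (trivialFibrations D).llp

/-- A Quillen adjunction: the left adjoint preserves cofibrations and trivial cofibrations. -/
structure IsQuillenAdjunction {F : C ⥤ D} {G : D ⥤ C} (adj : F ⊣ G) : Prop where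
  cofibrations_le : cofibrations C ≤ (cofibrations D).inverseImage F
  trivialCofibrations_le : trivialCofibrations C ≤ (trivialCofibrations D).inverseImage F

/-- A Quillen equivalence: a Quillen adjunction such that, for `X` cofibrant and `Y` fibrant,
a morphism `F X ⟶ Y` is a weak equivalence if and only if its adjoint `X ⟶ G Y` is one. -/
structure IsQuillenEquivalence {F : C ⥤ D} {G : D ⥤ C} (adj : F ⊣ G) : Prop
    extends IsQuillenAdjunction adj where
  weakEquivalence_iff_homEquiv (X : C) (Y : D) [IsCofibrant X] [IsFibrant Y]
    (f : F.obj X ⟶ Y) : WeakEquivalence f ↔ WeakEquivalence (adj.homEquiv X Y f)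

end Model

end DoldKanQuillen

/-! Over a field every linear map splits, so an acyclic complex is contractible. A contraction only
has components landing in positive degrees, so maps out of an acyclic complex lift along every chain
map that is surjective in positive degrees; these maps are the fibrations. An injective
quasi-isomorphism splits off its acyclic cokernel, hence lifts against fibrations
(`hasLiftingProperty_of_mono_of_quasiIso`).

Both factorizations come from the small object argument: one from monomorphisms in a Grothendieck
abelian category, the other from the inclusions of zero into disks. The resulting classes are
identified in `rlp_monomorphisms_eq` and `llp_positiveEpi`; the key points are that injective
complexes are acyclic and, dually, so are complexes with the left lifting property against
fibrations.

Since `coInd` is an equivalence, the model structure transports to simplicial vector spaces and the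
Quillen equivalence is formal. The remaining content is that `CycleRel` is the homology relation of
the Moore complex: subtracting degeneracies moves the unique nonzero face of a simplex from one
position to the next, up to sign. -/

open scoped ZeroObject

namespace DoldKanQuillen

/-! ### Small object argument for monomorphisms -/

section
universe w v u'
variable {C : Type u'} [Category.{v} C] [Abelian C] [IsGrothendieckAbelian.{w} C]

open MorphismProperty in
/-- In a Grothendieck abelian category, any small class of monomorphisms permits the small object
argument. -/
lemma hasSmallObjectArgument_of_le_monomorphisms (I : MorphismProperty C)
    [IsSmall.{w} I] (hI : I ≤ monomorphisms C) : HasSmallObjectArgument.{w} I := by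
  -- Every domain of a map in `I` embeds in `G`, so a regular `κ` exceeding the number of subobjects
  -- of `G` bounds all domains at once.
  let G : C := ∐ (fun j : Shrink.{w} I.toSet => ((equivShrink.{w} I.toSet).symm j).1.left)
  obtain ⟨κ, hκ', hκ⟩ := HasCardinalLT.exists_regular_cardinal.{w} (Subobject G)
  have : Fact κ.IsRegular := ⟨hκ'⟩
  have : Nonempty κ.ord.ToType := by simpa using hκ'.ne_zero
  have := WellFoundedLT.toOrderBot κ.ord.ToType
  exact ⟨κ, inferInstance, inferInstance,
    { preservesColimit {A B X Y} i hi f hf := by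
        -- Cell attachments along monomorphisms are monomorphisms, and a `κ`-bounded domain is small
        -- with respect to `κ`-chains of monomorphisms.
        let hf' : (monomorphisms C).TransfiniteCompositionOfShape κ.ord.ToType f :=
          { toTransfiniteCompositionOfShape := hf.toTransfiniteCompositionOfShape
            map_mem j hj := by
              have := (hf.attachCells j hj).pushouts_coproducts
              simp only [ofHoms_homFamily] at this
              refine (?_ : _ ≤ monomorphisms C) _ this
              simp only [pushouts_le_iff, coproducts_le_iff]
              exact hI }
        have (j j' : κ.ord.ToType) (φ : j ⟶ j') : Mono (hf'.F.map φ) := hf'.mem_map φ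
        apply IsGrothendieckAbelian.preservesColimit_coyoneda_obj_of_mono (Y := hf'.F) (κ := κ)
        let s : A ⟶ G := eqToHom (by simp) ≫ Sigma.ι
          (fun j : Shrink.{w} I.toSet => ((equivShrink.{w} I.toSet).symm j).1.left)
          (equivShrink.{w} I.toSet ⟨Arrow.mk i, hi⟩)
        exact Subobject.hasCardinalLT_of_mono hκ s }⟩
end

/-! ### Contractibility and lifting for complexes of vector spaces -/

section
variable {k : Type u} [Field k]

lemma isSplitMono_of_mono {M N : ModuleCat.{u} k} (f : M ⟶ N) [Mono f] : IsSplitMono f := by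
  obtain ⟨g, hg⟩ := f.hom.exists_leftInverse_of_injective
    (LinearMap.ker_eq_bot.2 ((ModuleCat.mono_iff_injective f).1 inferInstance))
  exact ⟨⟨⟨ModuleCat.ofHom g, by ext1; exact hg⟩⟩⟩

lemma isSplitEpi_of_epi {M N : ModuleCat.{u} k} (f : M ⟶ N) [Epi f] : IsSplitEpi f := by
  have : Module.Projective k N := Module.Projective.of_free
  obtain ⟨g, hg⟩ := f.hom.exists_rightInverse_of_surjective
    (LinearMap.range_eq_top.2 ((ModuleCat.epi_iff_surjective f).1 inferInstance))
  exact ⟨⟨⟨ModuleCat.ofHom g, by ext1; exact hg⟩⟩⟩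

lemma exists_comp_comp_eq_self {M N : ModuleCat.{u} k} (f : M ⟶ N) :
    ∃ s : N ⟶ M, f ≫ s ≫ f = f := by
  have := isSplitEpi_of_epi (Abelian.factorThruImage f)
  have := isSplitMono_of_mono (Abelian.image.ι f)
  refine ⟨retraction (Abelian.image.ι f) ≫ section_ (Abelian.factorThruImage f), ?_⟩
  have h : ∀ g : M ⟶ N, g = Abelian.factorThruImage f ≫ Abelian.image.ι f →
      g ≫ (retraction (Abelian.image.ι f) ≫ section_ (Abelian.factorThruImage f)) ≫ g = g := by
    rintro g rfl
    simp only [Category.assoc, IsSplitMono.id_assoc, IsSplitEpi.id_assoc]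
  exact h f (Abelian.image.fac f).symm

/-- An acyclic complex of vector spaces is contractible. -/
lemma exists_nullHomotopicMap_eq_id {K : DGMod k} (hK : K.Acyclic) :
    ∃ h : ∀ i j, (ComplexShape.down ℕ).Rel j i → (K.X i ⟶ K.X j),
      Homotopy.nullHomotopicMap' h = 𝟙 K := by
  have hex (n : ℕ) (x : K.X n) (hx : ∀ j, K.d n j x = 0) : ∃ y, K.d (n + 1) n y = x := by
    have h := hK n
    rw [K.exactAt_iff' (n + 1) n _ (by simp) rfl, ShortComplex.moduleCat_exact_iff] at h
    exact h x (hx _)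
  choose s hs using fun i j => exists_comp_comp_eq_self (K.d j i)
  have hs' (i j) (x : K.X j) : K.d j i (s i j (K.d j i x)) = K.d j i x :=
    ConcreteCategory.congr_hom (hs i j) x
  have hdd (i j l) (x : K.X i) : K.d j l (K.d i j x) = 0 :=
    ConcreteCategory.congr_hom (K.d_comp_d i j l) x
  -- With `dsd = d`, put `h = s(1 - sd)`. Then `hd = sd` because `d² = 0`, while `1 - sd` takes
  -- values in cycles, which are boundaries, where `ds` is the identity; so `dh + hd = 1`. In degree
  -- `0` the `dNext` term vanishes.
  refine ⟨fun i j _ => s i j - dNext i s ≫ s i j, ?_⟩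
  ext n x
  cases n with
  | zero =>
    rw [Homotopy.nullHomotopicMap'_f_of_not_rel_left (k₁ := 1) (by simp) (by simp)]
    obtain ⟨y, rfl⟩ := hex 0 x (fun j => by rw [K.shape _ _ (by simp)]; rfl)
    simp [dNext, hs']
  | succ n =>
    rw [Homotopy.nullHomotopicMap'_f (k₂ := n + 2) (k₀ := n) (by simp) (by simp),
      dNext_eq _ (show (ComplexShape.down ℕ).Rel (n + 1) n by simp)]
    obtain ⟨y, hy⟩ := hex (n + 1) (x - s n (n + 1) (K.d (n + 1) n x)) (fun j => by
      by_cases hj : j = n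
      · subst hj
        simp [hs']
      · rw [K.shape _ _ (fun h => hj (by simpa using h))]; rfl)
    have hy' := hs' (n + 1) (n + 2) y
    rw [hy] at hy'
    simp at hy'
    simp [hy']


lemma dgMod_mono_iff {K L : DGMod k} (f : K ⟶ L) : Mono f ↔ ∀ n, Mono (f.f n) :=
  ⟨fun _ _ => inferInstance, fun _ => HomologicalComplex.mono_of_mono_f f inferInstance⟩

/-- The morphisms of complexes that are surjective in positive degrees. -/
def positiveEpi (k : Type u) [Field k] : MorphismProperty (DGMod k) :=
  fun _ _ p => ∀ n, Epi (p.f (n + 1))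

/-- Contracting `C` makes `g` null-homotopic. The null-homotopy lands in positive degrees only, so
composing it with degreewise sections of `p`, which need not commute with `d`, yields a chain map
lifting `g`. -/
lemma exists_lift_of_acyclic {C X Y : DGMod k} (hC : C.Acyclic) {p : X ⟶ Y}
    (hp : positiveEpi k p) (g : C ⟶ Y) : ∃ l : C ⟶ X, l ≫ p = g := by
  obtain ⟨h, hh⟩ := exists_nullHomotopicMap_eq_id hC
  have (i j : ℕ) (hij : (ComplexShape.down ℕ).Rel j i) : ∃ s : Y.X j ⟶ X.X j, s ≫ p.f j = 𝟙 _ := by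
    obtain rfl : i + 1 = j := by simpa using hij
    have := hp i
    have := isSplitEpi_of_epi (p.f (i + 1))
    exact ⟨section_ _, IsSplitEpi.id _⟩
  choose s hs using this
  refine ⟨Homotopy.nullHomotopicMap' fun i j hij => h i j hij ≫ g.f j ≫ s i j hij, ?_⟩
  rw [Homotopy.nullHomotopicMap'_comp]
  simp only [Category.assoc, hs, Category.comp_id]
  rw [← Homotopy.nullHomotopicMap'_comp, hh, Category.id_comp]

lemma acyclic_cokernel {A B : DGMod k} (i : A ⟶ B) [Mono i] [QuasiIso i] :
    (cokernel i).Acyclic := by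
  have : (ShortComplex.mk _ _ (cokernel.condition i)).ShortExact :=
    { exact := ShortComplex.exact_cokernel i }
  exact this.acyclic_X₃ (by dsimp; infer_instance)

lemma quasiIso_of_acyclic_cokernel {A B : DGMod k} (i : A ⟶ B) [Mono i]
    (h : (cokernel i).Acyclic) : QuasiIso i := by
  have : (ShortComplex.mk _ _ (cokernel.condition i)).ShortExact :=
    { exact := ShortComplex.exact_cokernel i }
  rw [quasiIso_iff]
  intro n
  rw [quasiIsoAt_iff_isIso_homologyMap]
  have h₁ : Mono (HomologicalComplex.homologyMap i n) :=
    (this.homology_exact₁ (n + 1) n (by simp)).mono_g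
      (((HomologicalComplex.exactAt_iff_isZero_homology _ _).1 (h (n + 1))).eq_of_src _ _)
  have h₂ : Epi (HomologicalComplex.homologyMap i n) :=
    (this.homology_exact₂ n).epi_f
      (((HomologicalComplex.exactAt_iff_isZero_homology _ _).1 (h n)).eq_of_tgt _ _)
  exact isIso_of_mono_of_epi _

lemma quasiIso_of_acyclic_kernel {X Y : DGMod k} (p : X ⟶ Y) [Epi p]
    (h : (kernel p).Acyclic) : QuasiIso p := by
  have : (ShortComplex.mk _ _ (kernel.condition p)).ShortExact :=
    { exact := ShortComplex.exact_kernel p }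
  rw [quasiIso_iff]
  intro n
  rw [quasiIsoAt_iff_isIso_homologyMap]
  have h₁ : Mono (HomologicalComplex.homologyMap p n) :=
    (this.homology_exact₂ n).mono_g
      (((HomologicalComplex.exactAt_iff_isZero_homology _ _).1 (h n)).eq_of_src _ _)
  have h₂ : Epi (HomologicalComplex.homologyMap p n) := by
    cases n with
    -- There is no connecting map out of degree `0`; there homology is a cokernel, so it preserves
    -- epimorphisms.
    | zero => exact HomologicalComplex.epi_homologyMap_of_epi_of_not_rel _ _ (by simp)
    | succ n =>
      exact (this.homology_exact₃ (n + 1) n (by simp)).epi_f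
        (((HomologicalComplex.exactAt_iff_isZero_homology _ _).1 (h n)).eq_of_tgt _ _)
  exact isIso_of_mono_of_epi _

/-- Injective quasi-isomorphisms have the left lifting property against the morphisms that are
surjective in positive degrees. -/
lemma hasLiftingProperty_of_mono_of_quasiIso {A B X Y : DGMod k} (i : A ⟶ B) [Mono i] [QuasiIso i]
    (p : X ⟶ Y) (hp : positiveEpi k p) : HasLiftingProperty i p where
  sq_hasLift {u v} sq := by
    -- Lifting the identity of the acyclic cokernel splits `B` as `A ⊕ coker i`; the lift is `u` on
    -- the first summand and a lift of `s ≫ v` on the second.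
    have hC := acyclic_cokernel i
    obtain ⟨s, hs⟩ := exists_lift_of_acyclic hC (p := cokernel.π i)
      (fun n => inferInstance) (𝟙 _)
    obtain ⟨l, hl⟩ := exists_lift_of_acyclic hC hp (s ≫ v)
    let S := ShortComplex.mk _ _ (cokernel.condition i)
    have hS : S.ShortExact := { exact := ShortComplex.exact_cokernel i }
    let σ := ShortComplex.Splitting.ofExactOfSection S hS.exact s hs (by dsimp [S]; infer_instance)
    have hr : i ≫ σ.r = 𝟙 _ := σ.f_r
    have hid : σ.r ≫ i + cokernel.π i ≫ s = 𝟙 _ := σ.id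
    refine ⟨⟨⟨σ.r ≫ u + cokernel.π i ≫ l, ?_, ?_⟩⟩⟩
    · simp [reassoc_of% hr]
    · rw [Preadditive.add_comp, Category.assoc, sq.w, Category.assoc, hl, ← Category.assoc,
        ← Category.assoc, ← Preadditive.add_comp, hid, Category.id_comp]

/-! ### Trivial fibrations -/

lemma isSplitEpi_of_mem_rlp_monomorphisms {X Y : DGMod k} (p : X ⟶ Y)
    (hp : (MorphismProperty.monomorphisms (DGMod k)).rlp p) : IsSplitEpi p := by
  have := hp (0 : 0 ⟶ Y) (show Mono _ from inferInstance)
  have sq : CommSq (0 : 0 ⟶ X) (0 : 0 ⟶ Y) p (𝟙 Y) := ⟨by simp⟩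
  exact ⟨⟨sq.lift, sq.fac_right⟩⟩

/-- The `n`-sphere on the cycles `Z_n` embeds in the `(n + 1)`-disk on `Z_n`. Extending the
inclusion `Z_n ⟶ K_n` over the disk exhibits every cycle as a boundary. -/
lemma acyclic_of_injective (K : DGMod k) [Injective K] : K.Acyclic := by
  intro n
  let φ : (HomologicalComplex.single _ _ n).obj (K.cycles n) ⟶
      HomologicalComplex.double (c := ComplexShape.down ℕ) (𝟙 (K.cycles n))
        (show (ComplexShape.down ℕ).Rel (n + 1) n by simp) :=
    HomologicalComplex.mkHomFromSingle (HomologicalComplex.doubleXIso₁ _ _ (by simp)).inv (by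
      intro j hj
      rw [HomologicalComplex.double_d_eq_zero₀ _ _ _ _ (by simp), comp_zero])
  have : Mono φ := by
    rw [dgMod_mono_iff]
    intro m
    by_cases hm : m = n
    · subst hm
      simp only [φ, HomologicalComplex.mkHomFromSingle_f]
      infer_instance
    · have := (HomologicalComplex.isZero_single_obj_X (ComplexShape.down ℕ) n (K.cycles n) m hm)
      exact ⟨fun _ _ _ => this.eq_of_tgt _ _⟩
  let ψ : (HomologicalComplex.single _ (ComplexShape.down ℕ) n).obj (K.cycles n) ⟶ K :=
    HomologicalComplex.mkHomFromSingle (K.iCycles n) (by simp)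
  have hn : n + 1 ≠ n := by simp
  obtain ⟨f, hf⟩ : ∃ f, φ ≫ f = ψ := ⟨_, Injective.comp_factorThru ψ φ⟩
  have h := HomologicalComplex.congr_hom hf n
  simp only [φ, ψ, HomologicalComplex.comp_f, HomologicalComplex.mkHomFromSingle_f,
    Category.assoc, cancel_epi] at h
  have h2 := f.comm (n + 1) n
  rw [HomologicalComplex.double_d _ _ hn] at h2
  rw [HomologicalComplex.exactAt_iff, ShortComplex.exact_iff_iCycles_pOpcycles_zero]
  change K.iCycles n ≫ K.pOpcycles n = 0
  have h3 : K.iCycles n =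
      (HomologicalComplex.doubleXIso₀ _ _).inv ≫ f.f (n + 1) ≫ K.d (n + 1) n := by
    rw [h2]
    simp [h]
  simp only [h3, Category.assoc, HomologicalComplex.d_pOpcycles, comp_zero]

lemma rlp_monomorphisms_le : (MorphismProperty.monomorphisms (DGMod k)).rlp ≤
    positiveEpi k ⊓ HomologicalComplex.quasiIso _ _ := by
  intro X Y p hp
  have := isSplitEpi_of_mem_rlp_monomorphisms p hp
  have : Injective (kernel p) := by
    refine ⟨fun {A B} f i _ => ?_⟩
    have := hp i ‹_›
    have sq : CommSq (f ≫ kernel.ι p) i p 0 := ⟨by simp⟩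
    refine ⟨kernel.lift p sq.lift sq.fac_right, ?_⟩
    simp [← cancel_mono (kernel.ι p)]
  exact ⟨fun n => inferInstance, quasiIso_of_acyclic_kernel p (acyclic_of_injective _)⟩

/-- Trivial fibrations of complexes of vector spaces. -/
lemma rlp_monomorphisms_eq : (MorphismProperty.monomorphisms (DGMod k)).rlp =
    positiveEpi k ⊓ HomologicalComplex.quasiIso _ _ := by
  refine le_antisymm rlp_monomorphisms_le fun X Y p ⟨hp, (hp' : QuasiIso p)⟩ => ?_
  -- Retract argument: by two-out-of-three the monomorphism `h.i` is a quasi-isomorphism, so it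
  -- lifts against `p` and `p` is a retract of `h.p`.
  have h := IsGrothendieckAbelian.monoMapFactorizationDataRlp.{u} p
  have hi : Mono h.i := h.hi
  have : QuasiIso h.p := (rlp_monomorphisms_le _ h.hp).2
  have : QuasiIso (h.i ≫ h.p) := by rwa [h.fac]
  have : QuasiIso h.i := quasiIso_of_comp_right h.i h.p
  have := hasLiftingProperty_of_mono_of_quasiIso h.i p hp
  exact MorphismProperty.of_retract (RetractArrow.ofRightLiftingProperty h.fac) h.hp

/-! ### Disks and trivial cofibrations -/

/-- The inclusion of zero into the disk of dimension `n + 1`. -/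
noncomputable def diskInclusion (k : Type u) [Field k] (n : ℕ) :
    (0 : DGMod k) ⟶ HomologicalComplex.double (c := ComplexShape.down ℕ) (𝟙 (ModuleCat.of k k))
        (show (ComplexShape.down ℕ).Rel (n + 1) n by simp) := 0

/-- The inclusions of zero into the disks. -/
def diskInclusions (k : Type u) [Field k] : MorphismProperty (DGMod k) :=
  MorphismProperty.ofHoms (diskInclusion k)

instance : MorphismProperty.IsSmall.{u} (diskInclusions k) := by
  have : Small.{u} ℕ := inferInstance
  exact MorphismProperty.isSmall_ofHoms _

lemma diskInclusions_le_monomorphisms :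
    diskInclusions k ≤ MorphismProperty.monomorphisms (DGMod k) := by
  rintro _ _ _ ⟨n⟩
  exact inferInstanceAs (Mono (0 : (0 : DGMod k) ⟶ _))

/-- The disk on `M` corepresents `X ↦ Hom(M, X_i)`, so lifting out of it is a condition in the
single degree `i`. -/
lemma hasLiftingProperty_zero_double_iff {X Y : DGMod k} (p : X ⟶ Y) (M : ModuleCat.{u} k)
    {i j : ℕ} (hij : (ComplexShape.down ℕ).Rel i j) :
    HasLiftingProperty (0 : 0 ⟶ HomologicalComplex.double (𝟙 M) hij) p ↔
      ∀ y : M ⟶ Y.X i, ∃ x : M ⟶ X.X i, x ≫ p.f i = y := by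
  have hne : i ≠ j := by rintro rfl; simp at hij
  let e := HomologicalComplex.evalCompCoyonedaCorepresentableByDoubleId hij hne M
  constructor
  · intro h y
    have sq : CommSq (0 : 0 ⟶ X) (0 : 0 ⟶ HomologicalComplex.double (𝟙 M) hij) p
      (e.homEquiv.symm y) := ⟨by simp⟩
    refine ⟨e.homEquiv sq.lift, ?_⟩
    exact (e.homEquiv_comp p sq.lift).symm.trans
      ((congrArg e.homEquiv sq.fac_right).trans (e.homEquiv.apply_symm_apply y))
  · refine fun h => ⟨fun {u v} sq => ?_⟩
    obtain ⟨x, hx⟩ := h (e.homEquiv v)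
    refine ⟨⟨⟨e.homEquiv.symm x, (isZero_zero _).eq_of_src _ _, ?_⟩⟩⟩
    apply e.homEquiv.injective
    exact (e.homEquiv_comp p _).trans
      ((congrArg (· ≫ p.f i) (e.homEquiv.apply_symm_apply x)).trans hx)

lemma diskInclusions_rlp : (diskInclusions k).rlp = positiveEpi k := by
  ext X Y p
  constructor
  · intro hp n
    rw [ModuleCat.epi_iff_surjective]
    intro y
    obtain ⟨x, hx⟩ := (hasLiftingProperty_zero_double_iff p (ModuleCat.of k k) _).1 (hp _ ⟨n⟩)
      (ModuleCat.ofHom (LinearMap.toSpanSingleton k _ y))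
    refine ⟨x (1 : k), ?_⟩
    have := ConcreteCategory.congr_hom hx (1 : k)
    simpa using this
  · rintro hp _ _ _ ⟨n⟩
    have := hp n
    have := isSplitEpi_of_epi (p.f (n + 1))
    refine (hasLiftingProperty_zero_double_iff _ _ _).2 ?_
    exact fun y => ⟨y ≫ section_ (p.f (n + 1)), by simp⟩

/-- Dual to `acyclic_of_injective`: the projection of `C_n` onto its quotient by boundaries is a map
to a sphere. Lifting it along disk ⟶ sphere factors it through `d`, so it kills cycles. In degree
`0` the map from zero to the sphere is already a fibration and replaces the disk. -/
lemma acyclic_of_llp {C : DGMod k} (hC : (positiveEpi k).llp (0 : 0 ⟶ C)) : C.Acyclic := by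
  intro n
  rw [HomologicalComplex.exactAt_iff, ShortComplex.exact_iff_iCycles_pOpcycles_zero]
  change C.iCycles n ≫ C.pOpcycles n = 0
  let ψ : C ⟶ (HomologicalComplex.single _ _ n).obj (C.opcycles n) :=
    HomologicalComplex.mkHomToSingle (C.pOpcycles n) (by simp)
  obtain _ | n := n
  · have : positiveEpi k
        (0 : 0 ⟶ (HomologicalComplex.single _ (ComplexShape.down ℕ) 0).obj (C.opcycles 0)) := by
      intro m
      have := HomologicalComplex.isZero_single_obj_X (ComplexShape.down ℕ) 0 (C.opcycles 0)
        (m + 1) (by simp)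
      exact ⟨fun _ _ _ => this.eq_of_src _ _⟩
    have := hC _ this
    have sq : CommSq (0 : (0 : DGMod k) ⟶ 0) (0 : 0 ⟶ C)
      (0 : 0 ⟶ (HomologicalComplex.single _ (ComplexShape.down ℕ) 0).obj (C.opcycles 0)) ψ :=
      ⟨by simp⟩
    have h := HomologicalComplex.congr_hom sq.fac_right 0
    simp only [comp_zero, HomologicalComplex.zero_f, ψ, HomologicalComplex.mkHomToSingle_f] at h
    have : C.pOpcycles 0 = 0 := by
      rw [← cancel_mono (HomologicalComplex.singleObjXSelf (ComplexShape.down ℕ) 0 _).inv,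
        ← h, zero_comp]
    rw [this, comp_zero]
  · have hn : n + 1 ≠ n := by simp
    let φ : HomologicalComplex.double (c := ComplexShape.down ℕ) (𝟙 (C.opcycles (n + 1)))
        (show (ComplexShape.down ℕ).Rel (n + 1) n by simp) ⟶
        (HomologicalComplex.single _ (ComplexShape.down ℕ) (n + 1)).obj (C.opcycles (n + 1)) :=
      HomologicalComplex.mkHomToSingle (HomologicalComplex.doubleXIso₀ _ _).hom (by
        intro j hj
        rw [HomologicalComplex.double_d_eq_zero₁ _ _ _ _ (by simp), zero_comp])
    have hφ : positiveEpi k φ := by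
      intro m
      by_cases hm : m = n
      · subst hm
        simp only [φ, HomologicalComplex.mkHomToSingle_f]
        infer_instance
      · have := HomologicalComplex.isZero_single_obj_X (ComplexShape.down ℕ) (n + 1)
          (C.opcycles (n + 1)) (m + 1) (by simpa using hm)
        exact ⟨fun _ _ _ => this.eq_of_src _ _⟩
    have := hC _ hφ
    have sq : CommSq (0 : (0 : DGMod k) ⟶ _) (0 : 0 ⟶ C) φ ψ := ⟨by simp⟩
    obtain ⟨f, hf⟩ : ∃ f, f ≫ φ = ψ := ⟨sq.lift, sq.fac_right⟩
    have h := HomologicalComplex.congr_hom hf (n + 1)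
    simp only [φ, ψ, HomologicalComplex.comp_f, HomologicalComplex.mkHomToSingle_f,
      ← Category.assoc, cancel_mono] at h
    have h2 := f.comm (n + 1) n
    rw [HomologicalComplex.double_d _ _ hn] at h2
    have h3 : C.pOpcycles (n + 1) =
        C.d (n + 1) n ≫ f.f n ≫ (HomologicalComplex.doubleXIso₁ _ _ hn).hom := by
      rw [← reassoc_of% h2]
      simp [h]
    simp only [h3, HomologicalComplex.iCycles_d_assoc, zero_comp]

lemma llp_positiveEpi : (positiveEpi k).llp =
    MorphismProperty.monomorphisms (DGMod k) ⊓ HomologicalComplex.quasiIso _ _ := by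
  refine le_antisymm (fun A B i hi => ?_) (fun A B i ⟨(_ : Mono i), (_ : QuasiIso i)⟩ X Y p hp =>
    hasLiftingProperty_of_mono_of_quasiIso i p hp)
  have : Mono i := by
    change MorphismProperty.monomorphisms _ i
    -- Lifting against all fibrations includes lifting against trivial ones, which characterizes
    -- monomorphisms.
    rw [← IsGrothendieckAbelian.llp_rlp_monomorphisms.{u} (isSeparator_separator (DGMod k)),
      rlp_monomorphisms_eq]
    exact MorphismProperty.antitone_llp inf_le_left _ hi
  refine ⟨this, quasiIso_of_acyclic_cokernel i (acyclic_of_llp ?_)⟩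
  -- The map from zero to `cokernel i` is a pushout of `i`, so it inherits the lifting property.
  intro X Y p hp
  refine ⟨fun {u v} sq => ?_⟩
  have := hi p hp
  have sq' : CommSq 0 i p (cokernel.π i ≫ v) := ⟨by simp⟩
  exact ⟨⟨⟨cokernel.desc i sq'.lift sq'.fac_left, (isZero_zero _).eq_of_src _ _,
    by simp [← cancel_epi (cokernel.π i)]⟩⟩⟩

end

/-! ### The two model structures and the Quillen equivalence -/

section
variable (k : Type u) [Field k]

instance isWeakFactorizationSystem_monomorphisms :
    MorphismProperty.IsWeakFactorizationSystem (MorphismProperty.monomorphisms (DGMod k))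
      (positiveEpi k ⊓ HomologicalComplex.quasiIso _ _) where
  rlp := rlp_monomorphisms_eq
  llp := by
    rw [← rlp_monomorphisms_eq]
    exact IsGrothendieckAbelian.llp_rlp_monomorphisms.{u} (isSeparator_separator (DGMod k))
  hasFactorization := by
    have : MorphismProperty.HasFunctorialFactorization (MorphismProperty.monomorphisms (DGMod k))
        (MorphismProperty.monomorphisms (DGMod k)).rlp :=
      IsGrothendieckAbelian.instHasFunctorialFactorizationMonomorphismsRlp.{u}
    rw [← rlp_monomorphisms_eq]
    infer_instance

instance hasSmallObjectArgument_diskInclusions :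
    MorphismProperty.HasSmallObjectArgument.{u} (diskInclusions k) :=
  hasSmallObjectArgument_of_le_monomorphisms.{u} _ diskInclusions_le_monomorphisms

instance isWeakFactorizationSystem_positiveEpi :
    MorphismProperty.IsWeakFactorizationSystem
      (MorphismProperty.monomorphisms (DGMod k) ⊓ HomologicalComplex.quasiIso _ _)
      (positiveEpi k) where
  rlp := by
    rw [← llp_positiveEpi, ← diskInclusions_rlp, MorphismProperty.rlp_llp_rlp]
  llp := llp_positiveEpi
  hasFactorization := by
    rw [← llp_positiveEpi, ← diskInclusions_rlp]
    infer_instance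

/-- The model structure on complexes of vector spaces: the cofibrations are the monomorphisms and
the weak equivalences are the quasi-isomorphisms. -/
noncomputable abbrev dgModelCategory : ModelCategory (DGMod k) :=
  letI : CategoryWithFibrations (DGMod k) := ⟨positiveEpi k⟩
  letI : CategoryWithCofibrations (DGMod k) := ⟨MorphismProperty.monomorphisms (DGMod k)⟩
  letI : CategoryWithWeakEquivalences (DGMod k) := ⟨HomologicalComplex.quasiIso _ _⟩
  haveI : (weakEquivalences (DGMod k)).HasTwoOutOfThreeProperty :=
    inferInstanceAs (HomologicalComplex.quasiIso _ _).HasTwoOutOfThreeProperty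
  haveI : (cofibrations (DGMod k)).IsWeakFactorizationSystem (trivialFibrations (DGMod k)) :=
    isWeakFactorizationSystem_monomorphisms k
  haveI : (trivialCofibrations (DGMod k)).IsWeakFactorizationSystem (fibrations (DGMod k)) :=
    isWeakFactorizationSystem_positiveEpi k
  ModelCategory.mk' _

attribute [local instance] dgModelCategory

lemma isCofibrantlyGenerated_dgMod : IsCofibrantlyGenerated.{u} (DGMod k) :=
  ⟨IsGrothendieckAbelian.generatingMonomorphisms (separator (DGMod k)), diskInclusions k,
    inferInstance, inferInstance,
    (MorphismProperty.rlp_eq_of_wfs (cofibrations (DGMod k))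
      (trivialFibrations (DGMod k))).symm.trans
      (IsGrothendieckAbelian.generatingMonomorphisms_rlp.{u}
        (isSeparator_separator (DGMod k))).symm, diskInclusions_rlp.symm⟩

/-- The Dold-Kan equivalence. -/
noncomputable abbrev doldKanEquivalence : SMod k ≌ DGMod k := Abelian.DoldKan.equivalence

instance : (coInd k).IsEquivalence := (doldKanEquivalence k).isEquivalence_functor

/-- The model structure on simplicial vector spaces transported along the Dold-Kan
equivalence. -/
noncomputable abbrev simplicialModelCategory : ModelCategory (SMod k) :=
  letI : CategoryWithFibrations (SMod k) := ⟨(fibrations (DGMod k)).inverseImage (coInd k)⟩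
  letI : CategoryWithCofibrations (SMod k) := ⟨(cofibrations (DGMod k)).inverseImage (coInd k)⟩
  letI : CategoryWithWeakEquivalences (SMod k) :=
    ⟨(weakEquivalences (DGMod k)).inverseImage (coInd k)⟩
  ModelCategory.transport (doldKanEquivalence k) rfl rfl rfl

attribute [local instance] simplicialModelCategory

lemma isTransferredAlong_coInd : IsTransferredAlong (coInd k) where
  weakEquivalences_eq := rfl
  fibrations_eq := rfl
  cofibrations_eq :=
    (MorphismProperty.llp_eq_of_wfs (cofibrations (SMod k)) (trivialFibrations (SMod k))).symm

lemma cofibrations_sMod : cofibrations (SMod k) = MorphismProperty.monomorphisms _ := by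
  ext X Y f
  change Mono ((coInd k).map f) ↔ Mono f
  exact (coInd k).mono_map_iff_mono f

lemma isCofibrantlyGenerated_sMod : IsCofibrantlyGenerated.{u} (SMod k) := by
  have : IsGrothendieckAbelian.{u} (SMod k) :=
    IsGrothendieckAbelian.of_equivalence (doldKanEquivalence k).symm
  let J : MorphismProperty (SMod k) :=
    MorphismProperty.ofHoms fun n => (res k).map (diskInclusion k n)
  -- Lifting problems against the images of the disk inclusions are adjoint to those against the
  -- disk inclusions.
  have hJ : fibrations (SMod k) = J.rlp := by
    ext X Y p
    have h : fibrations (SMod k) p ↔ (diskInclusions k).rlp ((coInd k).map p) := by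
      rw [diskInclusions_rlp]; rfl
    rw [h]
    constructor
    · rintro hp _ _ _ ⟨n⟩
      exact ((doldKanAdjunction k).hasLiftingProperty_iff _ _).2 (hp _ ⟨n⟩)
    · rintro hp _ _ _ ⟨n⟩
      exact ((doldKanAdjunction k).hasLiftingProperty_iff _ _).1 (hp _ ⟨n⟩)
  have hJ' : J ≤ MorphismProperty.monomorphisms (SMod k) := by
    rintro _ _ _ ⟨n⟩
    have : Mono (diskInclusion k n) := diskInclusions_le_monomorphisms _ ⟨n⟩
    have : (res k).IsEquivalence := (doldKanEquivalence k).isEquivalence_inverse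
    exact inferInstanceAs (Mono ((res k).map (diskInclusion k n)))
  have : MorphismProperty.IsSmall.{u} J := MorphismProperty.isSmall_ofHoms _
  refine ⟨IsGrothendieckAbelian.generatingMonomorphisms (separator (SMod k)), J,
    inferInstance, hasSmallObjectArgument_of_le_monomorphisms.{u} J hJ', ?_, hJ⟩
  rw [IsGrothendieckAbelian.generatingMonomorphisms_rlp.{u} (isSeparator_separator (SMod k)),
    ← cofibrations_sMod,
    MorphismProperty.rlp_eq_of_wfs (cofibrations (SMod k)) (trivialFibrations (SMod k))]

lemma isQuillenEquivalence (Res : DGMod k ⥤ SMod k) (adj : Res ⊣ coInd k) :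
    IsQuillenEquivalence adj := by
  have : Res.IsEquivalence := adj.isEquivalence_left_of_isEquivalence_right
  have h : cofibrations (DGMod k) ≤ (cofibrations (SMod k)).inverseImage Res := by
    rw [cofibrations_sMod]
    intro X Y f hf
    have : Mono f := hf
    exact (show Mono (Res.map f) from inferInstance)
  have hw : weakEquivalences (DGMod k) ≤ (weakEquivalences (SMod k)).inverseImage Res := by
    intro X Y f hf
    -- The unit is invertible, so `coInd (Res f)` is isomorphic to `f` as an arrow.
    exact ((weakEquivalences (DGMod k)).arrow_mk_iso_iff
      (Arrow.isoMk (asIso (adj.unit.app X)) (asIso (adj.unit.app Y))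
        (adj.unit.naturality f).symm)).1 hf
  refine { cofibrations_le := h
           trivialCofibrations_le := fun X Y f hf => ⟨h f hf.1, hw f hf.2⟩
           weakEquivalence_iff_homEquiv := fun X Y _ _ f => ?_ }
  rw [adj.homEquiv_unit, weakEquivalence_iff, weakEquivalence_iff]
  exact ((weakEquivalences (DGMod k)).cancel_left_of_respectsIso (adj.unit.app X) _).symm

end

/-! ### The homotopy relation via degeneracies -/

section
variable {k : Type u} [Field k]

lemma face_degeneracy_of_mem_cycles {X : SMod k} {n : ℕ} {x : X _⦋n⦌} (hx : x ∈ cycles X n)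
    (j : Fin (n + 1)) (i : Fin (n + 2)) (h₁ : i ≠ j.castSucc) (h₂ : i ≠ j.succ) :
    X.δ i (X.σ j x) = 0 := by
  cases n with
  | zero => fin_cases j; fin_cases i <;> simp_all
  | succ n =>
    rcases lt_or_ge i j.castSucc with h | h
    · obtain ⟨i, rfl⟩ := i.eq_castSucc_of_ne_last (ne_of_lt (h.trans_le (Fin.le_last _)))
      obtain ⟨j, rfl⟩ := j.exists_succ_eq.2 (by rintro rfl; simp at h)
      have := ConcreteCategory.congr_hom (X.δ_comp_σ_of_le (i := i) (j := j) (by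
        simpa [Fin.lt_def, Fin.le_def, Nat.lt_succ_iff] using h)) x
      simp only [ConcreteCategory.comp_apply] at this
      rw [this, hx i, map_zero]
    · have h' : j.succ < i := lt_of_le_of_ne
        (Fin.castSucc_lt_iff_succ_le.1 (lt_of_le_of_ne h h₁.symm)) h₂.symm
      obtain ⟨i, rfl⟩ := i.exists_succ_eq.2 (by rintro rfl; simp at h')
      obtain ⟨j, rfl⟩ := j.eq_castSucc_of_ne_last (by
        rintro rfl
        exact absurd h' (not_lt.2 (Fin.le_last _)))
      have := ConcreteCategory.congr_hom (X.δ_comp_σ_of_gt (i := i) (j := j) (by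
        simpa [Fin.lt_def] using h')) x
      simp only [ConcreteCategory.comp_apply] at this
      rw [this, hx i, map_zero]

lemma face_castSucc_degeneracy {X : SMod k} {n : ℕ} (x : X _⦋n⦌) (j : Fin (n + 1)) :
    X.δ j.castSucc (X.σ j x) = x :=
  ConcreteCategory.congr_hom (X.δ_comp_σ_self (i := j)) x

lemma face_succ_degeneracy {X : SMod k} {n : ℕ} (x : X _⦋n⦌) (j : Fin (n + 1)) :
    X.δ j.succ (X.σ j x) = x :=
  ConcreteCategory.congr_hom (X.δ_comp_σ_succ (i := j)) x

/-- `x` is the `j`-th face of a simplex all of whose other faces vanish. -/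
def IsOnlyFace (X : SMod k) {n : ℕ} (j : Fin (n + 2)) (x : X _⦋n⦌) : Prop :=
  ∃ z : X _⦋n + 1⦌, X.δ j z = x ∧ ∀ i, i ≠ j → X.δ i z = 0

lemma IsOnlyFace.neg {X : SMod k} {n : ℕ} {j : Fin (n + 2)} {x : X _⦋n⦌}
    (h : IsOnlyFace X j x) : IsOnlyFace X j (-x) := by
  obtain ⟨z, hz, hz'⟩ := h
  exact ⟨-z, by rw [map_neg, hz], fun i hi => by rw [map_neg, hz' i hi, neg_zero]⟩

/-- Since `x` is a cycle, `σ_j x` has faces `x` in positions `j` and `j + 1` and zero elsewhere.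
Subtracting it moves the nonzero face between these positions and changes its sign. -/
lemma isOnlyFace_succ_iff {X : SMod k} {n : ℕ} {x : X _⦋n⦌} (hx : x ∈ cycles X n)
    (j : Fin (n + 1)) : IsOnlyFace X j.succ x ↔ IsOnlyFace X j.castSucc x := by
  have hne : j.castSucc ≠ j.succ := (Fin.castSucc_lt_succ).ne
  have hs := face_degeneracy_of_mem_cycles hx j
  constructor
  · rintro ⟨z, hz, hz'⟩
    have : IsOnlyFace X j.castSucc (-x) := by
      refine ⟨z - X.σ j x, ?_, fun i hi => ?_⟩
      · rw [map_sub, hz' _ hne, face_castSucc_degeneracy, zero_sub]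
      · by_cases hi' : i = j.succ
        · rw [hi', map_sub, hz, face_succ_degeneracy, sub_self]
        · rw [map_sub, hz' _ hi', hs i hi hi', sub_zero]
    simpa using this.neg
  · rintro ⟨z, hz, hz'⟩
    have : IsOnlyFace X j.succ (-x) := by
      refine ⟨z - X.σ j x, ?_, fun i hi => ?_⟩
      · rw [map_sub, hz' _ hne.symm, face_succ_degeneracy, zero_sub]
      · by_cases hi' : i = j.castSucc
        · rw [hi', map_sub, hz, face_castSucc_degeneracy, sub_self]
        · rw [map_sub, hz' _ hi', hs i hi' hi, sub_zero]
    simpa using this.neg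

lemma isOnlyFace_iff_zero {X : SMod k} {n : ℕ} {x : X _⦋n⦌} (hx : x ∈ cycles X n)
    (j : Fin (n + 2)) : IsOnlyFace X j x ↔ IsOnlyFace X 0 x := by
  induction j using Fin.induction with
  | zero => rfl
  | succ j hj => rw [isOnlyFace_succ_iff hx, hj]

lemma sub_mem_cycles {X : SMod k} {n : ℕ} {x y : X _⦋n⦌} (hx : x ∈ cycles X n)
    (hy : y ∈ cycles X n) : x - y ∈ cycles X n := by
  cases n with
  | zero => trivial
  | succ n => exact fun i => by rw [map_sub, hx i, hy i, sub_zero]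

/-- Subtracting `σ_n y` from a homotopy clears its last face and leaves `x - y` as face `n`, which
then slides down to face `0`, where the Moore differential lives. -/
lemma cycleRel_iff {X : SMod k} {n : ℕ} (x y : cycles X n) :
    CycleRel X n x y ↔ IsOnlyFace X (0 : Fin (n + 2)) (x.1 - y.1) := by
  rw [← isOnlyFace_iff_zero (sub_mem_cycles x.2 y.2) (Fin.last n).castSucc]
  have hs := face_degeneracy_of_mem_cycles y.2 (Fin.last n)
  have hne : (Fin.last n).castSucc ≠ (Fin.last n).succ := (Fin.castSucc_lt_succ).ne
  have h (i : Fin (n + 2)) : i = (Fin.last n).castSucc ∨ i = (Fin.last n).succ ∨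
      ((i : ℕ) < n ∧ i ≠ (Fin.last n).castSucc ∧ i ≠ (Fin.last n).succ) := by
    simp only [Fin.ext_iff, ne_eq, Fin.val_castSucc, Fin.val_last, Fin.val_succ]
    lia
  constructor
  · rintro ⟨z, h₀, h₁, h₂⟩
    rw [← Fin.succ_last] at h₂
    refine ⟨z - X.σ (Fin.last n) y.1, ?_, fun i hi => ?_⟩
    · rw [map_sub, h₁, face_castSucc_degeneracy]
    · obtain rfl | rfl | ⟨hi', hi₁, hi₂⟩ := h i
      · exact absurd rfl hi
      · rw [map_sub, h₂, face_succ_degeneracy, sub_self]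
      · rw [map_sub, h₀ i hi', hs i hi₁ hi₂, sub_zero]
  · rintro ⟨z, h₁, h₂⟩
    refine ⟨z + X.σ (Fin.last n) y.1, fun i hi => ?_, ?_, ?_⟩
    · have hi₁ : i ≠ (Fin.last n).castSucc := by rintro rfl; simp at hi
      have hi₂ : i ≠ (Fin.last n).succ := by rintro rfl; simp at hi
      rw [map_add, h₂ i hi₁, hs i hi₁ hi₂, add_zero]
    · rw [map_add, h₁, face_castSucc_degeneracy, sub_add_cancel]
    · rw [← Fin.succ_last, map_add, h₂ _ hne.symm, face_succ_degeneracy, zero_add]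

/-! ### Elements of the normalized Moore complex -/

open AlgebraicTopology in
/-- The inclusion of the normalized Moore complex. -/
noncomputable def mooreInclusion (X : SMod k) (n : ℕ) :
    ((coInd k).obj X).X n ⟶ X.obj (op ⦋n⦌) :=
  (NormalizedMooreComplex.objX X n).arrow

lemma mooreInclusion_injective (X : SMod k) (n : ℕ) :
    Function.Injective (mooreInclusion X n) :=
  (ModuleCat.mono_iff_injective _).1 (inferInstanceAs
    (Mono (AlgebraicTopology.NormalizedMooreComplex.objX X n).arrow))

open AlgebraicTopology Subobject in
lemma mooreInclusion_face_succ (X : SMod k) (n : ℕ) (i : Fin (n + 1)) :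
    mooreInclusion X (n + 1) ≫ X.δ i.succ = 0 := by
  change (NormalizedMooreComplex.objX X (n + 1)).arrow ≫ _ = 0
  dsimp only [NormalizedMooreComplex.objX]
  rw [← factorThru_arrow _ _ (finset_inf_arrow_factors Finset.univ _ i (by simp)),
    Category.assoc, kernelSubobject_arrow_comp]
  exact comp_zero

open AlgebraicTopology Subobject in
lemma exists_mooreInclusion_eq_of_face_succ_eq_zero (X : SMod k) (n : ℕ) (x : X _⦋n + 1⦌)
    (hx : ∀ i : Fin (n + 1), X.δ i.succ x = 0) : ∃ y, mooreInclusion X (n + 1) y = x := by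
  -- Encoding `x` as a map from `k` makes the factorization criterion for intersections of kernels
  -- applicable.
  let f : ModuleCat.of k k ⟶ X _⦋n + 1⦌ := ModuleCat.ofHom (LinearMap.toSpanSingleton k _ x)
  have hf : (NormalizedMooreComplex.objX X (n + 1)).Factors f := by
    dsimp only [NormalizedMooreComplex.objX]
    refine (finset_inf_factors _).mpr fun i _ => kernelSubobject_factors _ _ ?_
    ext
    simp [f, hx i]
  refine ⟨factorThru _ f hf (1 : k), ?_⟩
  exact (ConcreteCategory.congr_hom (factorThru_arrow _ f hf) (1 : k)).trans
    (LinearMap.toSpanSingleton_apply_one k _ x)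

open AlgebraicTopology Subobject in
lemma exists_mooreInclusion_zero_eq (X : SMod k) (x : X _⦋0⦌) :
    ∃ y, mooreInclusion X 0 y = x := by
  have : Epi (mooreInclusion X 0) :=
    inferInstanceAs (Epi (⊤ : Subobject (X.obj (op ⦋0⦌))).arrow)
  exact (ModuleCat.epi_iff_surjective _).1 this x

open AlgebraicTopology in
lemma d_comp_mooreInclusion (X : SMod k) (n : ℕ) :
    ((coInd k).obj X).d (n + 1) n ≫ mooreInclusion X n = mooreInclusion X (n + 1) ≫ X.δ 0 := by
  rw [normalizedMooreComplex_objD]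
  change NormalizedMooreComplex.objD X n ≫ (NormalizedMooreComplex.objX X n).arrow =
    (NormalizedMooreComplex.objX X (n + 1)).arrow ≫ X.δ 0
  cases n
  · simp [NormalizedMooreComplex.objD]
  · simp [NormalizedMooreComplex.objD]

open AlgebraicTopology in
lemma map_comp_mooreInclusion {X Y : SMod k} (f : X ⟶ Y) (n : ℕ) :
    ((coInd k).map f).f n ≫ mooreInclusion Y n = mooreInclusion X n ≫ f.app (op ⦋n⦌) := by
  rw [normalizedMooreComplex_map, NormalizedMooreComplex.map_f]
  exact Subobject.factorThru_arrow _ _ _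

/-! ### Moore homology and combinatorial homotopy groups -/

lemma homologyπ_eq_iff (K : DGMod k) (n : ℕ) (x y : K.cycles n) :
    K.homologyπ n x = K.homologyπ n y ↔
      ∃ z, K.d (n + 1) n z = K.iCycles n x - K.iCycles n y := by
  have hι : Function.Injective (K.homologyι n) :=
    (ModuleCat.mono_iff_injective _).1 inferInstance
  have hπι (x : K.cycles n) : K.homologyι n (K.homologyπ n x) = K.pOpcycles n (K.iCycles n x) :=
    ConcreteCategory.congr_hom (K.homology_π_ι n) x
  -- Homology embeds in the quotient by boundaries, so classes can be compared there.
  rw [← hι.eq_iff, hπι, hπι]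
  have h := (K.sc n).moduleCat_pOpcycles_eq_iff (K.iCycles n x) (K.iCycles n y)
  have hprev : (ComplexShape.down ℕ).prev n = n + 1 := by simp
  refine h.trans ?_
  change (∃ z, K.d ((ComplexShape.down ℕ).prev n) n z = _) ↔ _
  rw [hprev]
  exact Iff.rfl

lemma homologyπ_surjective (K : DGMod k) (n : ℕ) : Function.Surjective (K.homologyπ n) :=
  (ModuleCat.epi_iff_surjective _).1 inferInstance

lemma exists_iCycles_eq (K : DGMod k) (n : ℕ) (x : K.X n) (hx : ∀ j, K.d n j x = 0) :
    ∃ y, K.iCycles n y = x := by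
  let f : ModuleCat.of k k ⟶ K.X n := ModuleCat.ofHom (LinearMap.toSpanSingleton k _ x)
  have hf : f ≫ K.d n ((ComplexShape.down ℕ).next n) = 0 := by
    ext
    simp [f, hx]
  refine ⟨K.liftCycles f _ rfl hf (1 : k), ?_⟩
  exact (ConcreteCategory.congr_hom (K.liftCycles_i f _ rfl hf) (1 : k)).trans
    (LinearMap.toSpanSingleton_apply_one k _ x)

/-- The inclusion of the cycles of the normalized Moore complex. -/
noncomputable def mooreCyclesInclusion (X : SMod k) (n : ℕ) :
    ((coInd k).obj X).cycles n ⟶ X.obj (op ⦋n⦌) :=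
  ((coInd k).obj X).iCycles n ≫ mooreInclusion X n

lemma mooreCyclesInclusion_apply (X : SMod k) (n : ℕ) (x : ((coInd k).obj X).cycles n) :
    mooreCyclesInclusion X n x = mooreInclusion X n (((coInd k).obj X).iCycles n x) := rfl

lemma mooreInclusion_d (X : SMod k) (n : ℕ) (x : ((coInd k).obj X).X (n + 1)) :
    mooreInclusion X n (((coInd k).obj X).d (n + 1) n x) = X.δ 0 (mooreInclusion X (n + 1) x) :=
  ConcreteCategory.congr_hom (d_comp_mooreInclusion X n) x

lemma mooreCyclesInclusion_mem_cycles (X : SMod k) (n : ℕ) (x : ((coInd k).obj X).cycles n) :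
    mooreCyclesInclusion X n x ∈ cycles X n := by
  cases n with
  | zero => trivial
  | succ n =>
    intro i
    rw [mooreCyclesInclusion_apply]
    induction i using Fin.cases with
    | zero =>
      have h : ((coInd k).obj X).d (n + 1) n (((coInd k).obj X).iCycles (n + 1) x) = 0 :=
        ConcreteCategory.congr_hom (((coInd k).obj X).iCycles_d (n + 1) n) x
      rw [← mooreInclusion_d, h, map_zero]
    | succ i => exact ConcreteCategory.congr_hom (mooreInclusion_face_succ X n i) _

lemma exists_mooreCyclesInclusion_eq (X : SMod k) (n : ℕ) {x : X _⦋n⦌} (hx : x ∈ cycles X n) :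
    ∃ y, mooreCyclesInclusion X n y = x := by
  obtain ⟨y, rfl, hy⟩ : ∃ y, mooreInclusion X n y = x ∧ ∀ j, ((coInd k).obj X).d n j y = 0 := by
    cases n with
    | zero =>
      obtain ⟨y, hy⟩ := exists_mooreInclusion_zero_eq X x
      exact ⟨y, hy, fun j => by rw [HomologicalComplex.shape _ _ _ (by simp)]; rfl⟩
    | succ n =>
      obtain ⟨y, rfl⟩ := exists_mooreInclusion_eq_of_face_succ_eq_zero X n x fun i => hx _
      refine ⟨y, rfl, fun j => ?_⟩
      by_cases hj : j = n
      · subst hj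
        apply mooreInclusion_injective
        rw [mooreInclusion_d, map_zero]
        exact hx 0
      · rw [HomologicalComplex.shape _ _ _ (fun h => hj (by simpa using h))]; rfl
  obtain ⟨z, rfl⟩ := exists_iCycles_eq _ _ y hy
  exact ⟨z, rfl⟩

lemma homologyπ_eq_iff_cycleRel (X : SMod k) (n : ℕ) (x y : ((coInd k).obj X).cycles n) :
    ((coInd k).obj X).homologyπ n x = ((coInd k).obj X).homologyπ n y ↔
      CycleRel X n ⟨_, mooreCyclesInclusion_mem_cycles X n x⟩
        ⟨_, mooreCyclesInclusion_mem_cycles X n y⟩ := by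
  rw [homologyπ_eq_iff, cycleRel_iff]
  constructor
  · rintro ⟨z, hz⟩
    refine ⟨mooreInclusion X (n + 1) z, ?_, fun i hi => ?_⟩
    · rw [← mooreInclusion_d, hz, map_sub]
      rfl
    · obtain ⟨i, rfl⟩ := i.exists_succ_eq.2 hi
      exact ConcreteCategory.congr_hom (mooreInclusion_face_succ X n i) z
  · rintro ⟨z, hz, hz'⟩
    obtain ⟨z, rfl⟩ := exists_mooreInclusion_eq_of_face_succ_eq_zero X n z
      fun i => hz' _ (Fin.succ_ne_zero i)
    refine ⟨z, mooreInclusion_injective X n ?_⟩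
    rw [mooreInclusion_d, hz, map_sub]
    rfl

/-- The map sending the homology class of a cycle of the normalized Moore complex to its
homotopy class. -/
noncomputable def homologyToHomotopyGroup (X : SMod k) (n : ℕ)
    (c : ((coInd k).obj X).homology n) : HomotopyGroup X n :=
  Quot.mk _ ⟨_, mooreCyclesInclusion_mem_cycles X n
    (Function.surjInv (homologyπ_surjective ((coInd k).obj X) n) c)⟩

lemma homologyToHomotopyGroup_homologyπ (X : SMod k) (n : ℕ) (x : ((coInd k).obj X).cycles n) :
    homologyToHomotopyGroup X n (((coInd k).obj X).homologyπ n x) =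
      Quot.mk _ ⟨_, mooreCyclesInclusion_mem_cycles X n x⟩ :=
  Quot.sound ((homologyπ_eq_iff_cycleRel X n _ _).1 (Function.surjInv_eq _ _))

/-- The relation is pulled back from equality of homology classes. This is needed because
`HomotopyGroup` is a bare `Quot`, where equality otherwise means only the generated equivalence. -/
lemma cycleRel_equivalence (X : SMod k) (n : ℕ) : Equivalence (CycleRel X n) := by
  have h (x : cycles X n) :
      ∃ y, (⟨_, mooreCyclesInclusion_mem_cycles X n y⟩ : cycles X n) = x := by
    obtain ⟨y, hy⟩ := exists_mooreCyclesInclusion_eq X n x.2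
    exact ⟨y, Subtype.ext hy⟩
  refine ⟨fun x => ?_, fun {x y} hxy => ?_, fun {x y z} hxy hyz => ?_⟩
  · obtain ⟨x, rfl⟩ := h x
    exact (homologyπ_eq_iff_cycleRel X n x x).1 rfl
  · obtain ⟨x, rfl⟩ := h x
    obtain ⟨y, rfl⟩ := h y
    rw [← homologyπ_eq_iff_cycleRel] at hxy ⊢
    exact hxy.symm
  · obtain ⟨x, rfl⟩ := h x
    obtain ⟨y, rfl⟩ := h y
    obtain ⟨z, rfl⟩ := h z
    rw [← homologyπ_eq_iff_cycleRel] at hxy hyz ⊢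
    exact hxy.trans hyz

lemma homologyToHomotopyGroup_bijective (X : SMod k) (n : ℕ) :
    Function.Bijective (homologyToHomotopyGroup X n) := by
  constructor
  · intro c c' h
    obtain ⟨x, rfl⟩ := homologyπ_surjective _ n c
    obtain ⟨y, rfl⟩ := homologyπ_surjective _ n c'
    rw [homologyToHomotopyGroup_homologyπ, homologyToHomotopyGroup_homologyπ] at h
    exact (homologyπ_eq_iff_cycleRel X n x y).2
      (((cycleRel_equivalence X n).quot_mk_eq_iff _ _).1 h)
  · rintro ⟨x⟩
    obtain ⟨y, hy⟩ := exists_mooreCyclesInclusion_eq X n x.2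
    exact ⟨_, (homologyToHomotopyGroup_homologyπ X n y).trans
      (congrArg (Quot.mk _) (Subtype.ext hy))⟩

lemma homotopyGroupMap_homologyToHomotopyGroup {X Y : SMod k} (f : X ⟶ Y) (n : ℕ)
    (c : ((coInd k).obj X).homology n) :
    homotopyGroupMap f n (homologyToHomotopyGroup X n c) =
      homologyToHomotopyGroup Y n (HomologicalComplex.homologyMap ((coInd k).map f) n c) := by
  obtain ⟨x, rfl⟩ := homologyπ_surjective _ n c
  have h : HomologicalComplex.homologyMap ((coInd k).map f) n
      (((coInd k).obj X).homologyπ n x) = ((coInd k).obj Y).homologyπ n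
        (HomologicalComplex.cyclesMap ((coInd k).map f) n x) :=
    ConcreteCategory.congr_hom (HomologicalComplex.homologyπ_naturality ((coInd k).map f) n) x
  rw [h, homologyToHomotopyGroup_homologyπ, homologyToHomotopyGroup_homologyπ]
  refine congrArg (Quot.mk _) (Subtype.ext ?_)
  have : HomologicalComplex.cyclesMap ((coInd k).map f) n ≫ mooreCyclesInclusion Y n =
      mooreCyclesInclusion X n ≫ f.app (op ⦋n⦌) := by
    rw [mooreCyclesInclusion, mooreCyclesInclusion, HomologicalComplex.cyclesMap_i_assoc,
      map_comp_mooreInclusion, Category.assoc]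
  exact (ConcreteCategory.congr_hom this x).symm

/-- The homotopy equivalences are the morphisms inducing quasi-isomorphisms of normalized Moore
complexes. -/
lemma homotopyEquivalences_eq : homotopyEquivalences k =
    (HomologicalComplex.quasiIso (ModuleCat.{u} k) (ComplexShape.down ℕ)).inverseImage
      (coInd k) := by
  ext X Y f
  change (∀ n, Function.Bijective (homotopyGroupMap f n)) ↔ QuasiIso ((coInd k).map f)
  rw [quasiIso_iff]
  refine forall_congr' fun n => ?_
  rw [quasiIsoAt_iff_isIso_homologyMap, ConcreteCategory.isIso_iff_bijective,
    ← (homologyToHomotopyGroup_bijective Y n).of_comp_iff',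
    ← Function.Bijective.of_comp_iff _ (homologyToHomotopyGroup_bijective X n)]
  have : homotopyGroupMap f n ∘ homologyToHomotopyGroup X n =
      homologyToHomotopyGroup Y n ∘ HomologicalComplex.homologyMap ((coInd k).map f) n :=
    funext (homotopyGroupMap_homologyToHomotopyGroup f n)
  rw [this]

end

end DoldKanQuillen

theorem mainTheorem5 (k : Type u) [Field k] :
    ∃ (_ : ModelCategory (DoldKanQuillen.DGMod k)) (_ : ModelCategory (DoldKanQuillen.SMod k)),
      -- the model structure on differential graded vector spaces
      (cofibrations (DoldKanQuillen.DGMod k) = MorphismProperty.monomorphisms _ ∧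
        weakEquivalences (DoldKanQuillen.DGMod k) = HomologicalComplex.quasiIso _ _ ∧
        fibrations (DoldKanQuillen.DGMod k) = (trivialCofibrations (DoldKanQuillen.DGMod k)).rlp ∧
        DoldKanQuillen.IsCofibrantlyGenerated.{u} (DoldKanQuillen.DGMod k)) ∧
      -- the model structure on simplicial vector spaces is transferred from it
      (DoldKanQuillen.IsTransferredAlong (DoldKanQuillen.coInd k) ∧
        cofibrations (DoldKanQuillen.SMod k) = MorphismProperty.monomorphisms _ ∧
        weakEquivalences (DoldKanQuillen.SMod k) = DoldKanQuillen.homotopyEquivalences k ∧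
        DoldKanQuillen.IsCofibrantlyGenerated.{u} (DoldKanQuillen.SMod k)) ∧
      -- the Dold-Kan pair is a Quillen equivalence, whichever left adjoint is chosen
      DoldKanQuillen.IsQuillenEquivalence (DoldKanQuillen.doldKanAdjunction k) ∧
      ∀ (Res : DoldKanQuillen.DGMod k ⥤ DoldKanQuillen.SMod k)
        (adj : Res ⊣ DoldKanQuillen.coInd k), DoldKanQuillen.IsQuillenEquivalence adj := by
  refine ⟨DoldKanQuillen.dgModelCategory k, DoldKanQuillen.simplicialModelCategory k,
    ⟨rfl, rfl, ?_, DoldKanQuillen.isCofibrantlyGenerated_dgMod k⟩,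
    ⟨DoldKanQuillen.isTransferredAlong_coInd k, DoldKanQuillen.cofibrations_sMod k,
      DoldKanQuillen.homotopyEquivalences_eq.symm,
      DoldKanQuillen.isCofibrantlyGenerated_sMod k⟩,
    DoldKanQuillen.isQuillenEquivalence k _ _,
    fun Res adj => DoldKanQuillen.isQuillenEquivalence k Res adj⟩
  let _ := DoldKanQuillen.dgModelCategory k
  exact (MorphismProperty.rlp_eq_of_wfs (trivialCofibrations (DoldKanQuillen.DGMod k))
    (fibrations (DoldKanQuillen.DGMod k))).symm
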